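/- **Conventions.** An algebra is a nonempty set with finitary operations of a given type (the language); a variety is a class of algebras of one type that is closed under homomorphic images, subalgebras and direct products. The congruences of an algebra $\mathbf A$, ordered by inclusion, form a lattice $\operatorname{Con}\mathbf A$ with least element $0_A$ (equality); $\operatorname{Cg}(a,b)$ is the least congruence containing $(a,b)$. $\mathbf A$ is *congruence meet-semidistributive* if $x\wedge y=x\wedge z$ implies $x\wedge y=x\wedge(y\vee z)$ for all $x,y,z\in\operatorname{Con}\mathbf A$. For congruences $\alpha,\beta,\gamma$ of $\mathbf A$ put $\beta_0=\beta$, $\gamma_0=\gamma$, $\beta_{n+1}=\beta\vee(\alpha\cap\gamma_n)$, $\gamma_{n+1}=\gamma\vee(\alpha\cap\beta_n)$ and $\beta_\omega=\bigcup_{n<\omega}\beta_n$. $\mathbf A$ satisfies $\mathcal C_2$ if $\alpha\cap(\beta\circ\gamma)\subseteq\beta_\omega$ for all $\alpha,\beta,\gamma\in\operatorname{Con}\mathbf A$, where $(x,z)\in\beta\circ\gamma$ means that $(x,y)\in\beta$ and $(y,z)\in\gamma$ for some $y$. A variety has one of these properties if each of its members has it. A *coloured ordered tree* is a finite rooted tree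 $T$ with a linear order on the children of each node and a map $\chi$ from its nodes to $\{\mathbf b,\mathbf g\}$ such that the colour of a child is always opposite to the colour of its parent. A variety $\mathcal V$ *satisfies* $\mathcal C_2(T)$ if there are ternary terms $s_p,t_p$ ($p\in T$) in the language of $\mathcal V$ such that the following are identities of $\mathcal V$, where $0$ is the root: 1. $s_0(x,y,z)\approx x$ and $t_0(x,y,z)\approx z$; 2. $s_p(x,y,x)\approx t_p(x,y,x)$ for all $p\in T$; 3. if $r$ is the first child of $p$: $s_p(x,x,y)\approx s_r(x,x,y)$ when $\chi(p)=\mathbf b$, and $s_p(x,y,y)\approx s_r(x,y,y)$ when $\chi(p)=\mathbf g$; 4. if $r$ is the last child of $p$: $t_p(x,x,y)\approx t_r(x,x,y)$ when $\chi(p)=\mathbf b$, and $t_p(x,y,y)\approx t_r(x,y,y)$ when $\chi(p)=\mathbf g$; 5. if $p,q$ are consecutive children, in that order, of a node $r$: $t_p(x,x,y)\approx s_q(x,x,y)$ when $\chi(r)=\mathbf b$, and $t_p(x,y,y)\approx s_q(x,y,y)$ when $\chi(r)=\mathbf g$; 6. if $p$ is a leaf: $s_p(x,x,y)\approx t_p(x,x,y)$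 when $\chi(p)=\mathbf b$, and $s_p(x,y,y)\approx t_p(x,y,y)$ when $\chi(p)=\mathbf g$. **Theorem 2.1.** For a variety $\mathcal V$, the following are equivalent: 1. $\mathcal V$ is congruence meet-semidistributive. 2. $\mathcal V$ satisfies $\mathcal C_2$. 3. The 3-generated free algebra in $\mathcal V$ is congruence meet-semidistributive. 4. The 3-generated free algebra in $\mathcal V$ satisfies $\mathcal C_2$. 5. $\mathcal V$ satisfies $\mathcal C_2(T)$ for some coloured ordered tree $T$. 6. There is a finite family of pairs $\langle s_p(x,y,z),t_p(x,y,z)\rangle$ $(p\in P)$ of ternary terms such that $\mathcal V\models s_p(x,y,x)\approx t_p(x,y,x)$ for all $p\in P$, and $$\mathcal V\models\forall x\,\forall y\,\Bigl(x=y\leftrightarrow\bigwedge_{p\in P}\bigl[s_p(x,x,y)=t_p(x,x,y)\leftrightarrow s_p(x,y,y)=t_p(x,y,y)\bigr]\Bigr).$$ 7. For all $\mathbf A\in\mathcal V$ and $a_0,a_1,\dots,a_n\in A$, if $a_0\ne a_n$ then there is $i<n$ such that $\operatorname{Cg}(a_0,a_n)\cap\operatorname{Cg}(a_i,a_{i+1})\ne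 0_A$. -/

import Mathlib

universe u v w

namespace UnivAlg

open FirstOrder FirstOrder.Language

/-! Throughout, a type of algebras is a first-order language `L` without relation symbols
(`[L.IsAlgebraic]`), and an algebra of this type is a type `A` with `[L.Structure A]`. -/

/-- Meet-semidistributivity of a lattice: `x ∧ y = x ∧ z` implies `x ∧ y = x ∧ (y ∨ z)`. -/
def IsMeetSemidistributive (P : Type*) [Lattice P] : Prop :=
  ∀ x y z : P, x ⊓ y = x ⊓ z → x ⊓ y = x ⊓ (y ⊔ z)

/-! ### Congruences -/

/-- A congruence of the algebra `A`: an equivalence relation that is compatible with every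
fundamental operation. -/
@[ext]
structure Congruence (L : FirstOrder.Language.{u, v}) (A : Type w) [L.Structure A] extends Setoid A where
  compat : ∀ {n : ℕ} (f : L.Functions n) (x y : Fin n → A),
    (∀ i, toSetoid (x i) (y i)) → toSetoid (Structure.funMap f x) (Structure.funMap f y)

namespace Congruence

variable {L : FirstOrder.Language.{u, v}} {A : Type w} [L.Structure A]

/-- `θ.Rel a b` says that the pair `(a, b)` belongs to the congruence `θ`. -/
def Rel (θ : Congruence L A) (a b : A) : Prop := θ.toSetoid a b

theorem toSetoid_injective :
    Function.Injective (Congruence.toSetoid : Congruence L A → Setoid A) := by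
  rintro ⟨s, hs⟩ ⟨t, ht⟩ h
  cases h
  rfl

/-- Congruences are ordered by inclusion. -/
instance : PartialOrder (Congruence L A) :=
  PartialOrder.lift Congruence.toSetoid toSetoid_injective

/-- The intersection of a set of congruences. -/
instance : InfSet (Congruence L A) where
  sInf S :=
    { r := fun a b => ∀ θ ∈ S, θ.toSetoid a b
      iseqv :=
        ⟨fun a θ _ => θ.refl' a, fun h θ hθ => θ.symm' (h θ hθ),
          fun h k θ hθ => θ.trans' (h θ hθ) (k θ hθ)⟩
      compat := fun f x y h θ hθ => θ.compat f x y fun i => h i θ hθ }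

/-- The intersection of two congruences. -/
instance : Min (Congruence L A) where
  min θ ψ :=
    { r := fun a b => θ.toSetoid a b ∧ ψ.toSetoid a b
      iseqv :=
        ⟨fun a => ⟨θ.refl' a, ψ.refl' a⟩, fun h => ⟨θ.symm' h.1, ψ.symm' h.2⟩,
          fun h k => ⟨θ.trans' h.1 k.1, ψ.trans' h.2 k.2⟩⟩
      compat := fun f x y h =>
        ⟨θ.compat f x y fun i => (h i).1, ψ.compat f x y fun i => (h i).2⟩ }

/-- The congruence `0_A`, that is, equality. -/
instance : Bot (Congruence L A) where
  bot :=
    { r := fun a b => a = b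
      iseqv := ⟨fun _ => rfl, Eq.symm, Eq.trans⟩
      compat := fun f _ _ h => congrArg (Structure.funMap f) (funext h) }

theorem isGLB_sInf (S : Set (Congruence L A)) : IsGLB S (sInf S) :=
  ⟨fun θ hθ _ _ h => h θ hθ, fun _ hψ _ _ h _ hθ => hψ hθ h⟩

/-- The congruence lattice `Con A`. Meets are intersections, the least element is equality,
and joins are the least upper bounds. -/
instance : CompleteLattice (Congruence L A) :=
  { completeLatticeOfInf (Congruence L A) isGLB_sInf with
    inf := fun θ ψ => θ ⊓ ψ
    inf_le_left := fun _ _ _ _ h => h.1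
    inf_le_right := fun _ _ _ _ h => h.2
    le_inf := fun _ _ _ h k _ _ r => ⟨h r, k r⟩
    bot := ⊥
    bot_le := fun θ a _ h => h ▸ θ.refl' a }

/-- The principal congruence `Cg(a, b)`: the least congruence containing the pair `(a, b)`. -/
def Cg (L : FirstOrder.Language.{u, v}) {A : Type w} [L.Structure A] (a b : A) : Congruence L A :=
  sInf {θ | θ.Rel a b}

/-- The pairs `(β_n, γ_n)` with `β_0 = β`, `γ_0 = γ`, `β_{n+1} = β ∨ (α ∩ γ_n)` and
`γ_{n+1} = γ ∨ (α ∩ β_n)`. -/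
def betaGamma (α β γ : Congruence L A) : ℕ → Congruence L A × Congruence L A
  | 0 => (β, γ)
  | n + 1 => (β ⊔ (α ⊓ (betaGamma α β γ n).2), γ ⊔ (α ⊓ (betaGamma α β γ n).1))

/-- The relation `β_ω`, the union of all the `β_n`. -/
def betaOmega (α β γ : Congruence L A) (x z : A) : Prop :=
  ∃ n : ℕ, (betaGamma α β γ n).1.Rel x z

/-- A congruence yields a quotient algebra. -/
instance prestructure [L.IsAlgebraic] (θ : Congruence L A) : L.Prestructure θ.toSetoid where
  toStructure := inferInstance
  fun_equiv := fun {_ f} x y h => θ.compat f x y h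
  rel_equiv := fun {_ r} => isEmptyElim r

end Congruence

/-- The algebra `A` is congruence meet-semidistributive. -/
def CongruenceMeetSD (L : FirstOrder.Language.{u, v}) (A : Type w) [L.Structure A] : Prop :=
  IsMeetSemidistributive (Congruence L A)

/-- The algebra `A` satisfies `C₂`: `α ∩ (β ∘ γ) ⊆ β_ω` for all congruences `α`, `β`, `γ`. -/
def SatisfiesC2 (L : FirstOrder.Language.{u, v}) (A : Type w) [L.Structure A] : Prop :=
  ∀ (α β γ : Congruence L A) (x z : A),
    α.Rel x z → Relation.Comp β.Rel γ.Rel x z → Congruence.betaOmega α β γ x z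

/-! ### Varieties and free algebras -/

/-- The direct product of a family of algebras, with coordinatewise operations. -/
instance piStructure {L : FirstOrder.Language.{u, v}} {ι : Type*} (A : ι → Type*)
    [∀ i, L.Structure (A i)] : L.Structure (∀ i, A i) where
  funMap f x := fun i => Structure.funMap f fun j => x j i
  RelMap r x := ∀ i, Structure.RelMap r fun j => x j i

/-- The term algebra over `X` (the absolutely free algebra). -/
instance termStructure {L : FirstOrder.Language.{u, v}} [L.IsAlgebraic] {X : Type*} :
    L.Structure (L.Term X) where
  funMap f ts := Term.func f ts
  RelMap r _ := isEmptyElim r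

/-- A variety of algebras of type `L`: a class of algebras that is closed under homomorphic
images, (nonempty) subalgebras and direct products. The algebras live in `Type (max u w)`,
where `u` is the universe of the operation symbols, so that the free algebras fit. -/
structure Variety (L : FirstOrder.Language.{u, v}) where
  /-- Membership of an algebra in the variety. -/
  Mem : ∀ (A : Type (max u w)) [L.Structure A], Prop
  hom_image : ∀ (A B : Type (max u w)) [L.Structure A] [L.Structure B] (f : A →[L] B),
    Function.Surjective f → Mem A → Mem B
  subalgebra : ∀ (A : Type (max u w)) [L.Structure A] (S : L.Substructure A),
    (S : Set A).Nonempty → Mem A → Mem S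
  product : ∀ (ι : Type (max u w)) (A : ι → Type (max u w)) [∀ i, L.Structure (A i)],
    (∀ i, Mem (A i)) → Mem (∀ i, A i)

/-- A ternary term, in the variables `x = 0`, `y = 1`, `z = 2`. -/
abbrev TernaryTerm (L : FirstOrder.Language.{u, v}) : Type u := L.Term (Fin 3)

/-- The value `t(a, b, c)` of a ternary term in an algebra. -/
def TernaryTerm.eval {L : FirstOrder.Language.{u, v}} {A : Type*} [L.Structure A] (t : TernaryTerm L)
    (a b c : A) : A :=
  Term.realize ![a, b, c] t

namespace Variety

variable {L : FirstOrder.Language.{u, v}}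

/-- The variety `V` satisfies the identity `s ≈ t`. -/
def Identity (V : Variety.{u, v, w} L) {X : Type*} (s t : L.Term X) : Prop :=
  ∀ (A : Type (max u w)) [L.Structure A], V.Mem A →
    ∀ a : X → A, s.realize a = t.realize a

/-- The congruence of the term algebra over `X` that consists of the identities of `V`. -/
def identityCongruence (V : Variety.{u, v, w} L) [L.IsAlgebraic] (X : Type*) :
    Congruence L (L.Term X) where
  r s t := V.Identity s t
  iseqv :=
    ⟨fun _ _ _ _ _ => rfl, fun h A _ hA a => (h A hA a).symm,
      fun h k A _ hA a => (h A hA a).trans (k A hA a)⟩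
  compat := fun f _ _ h A _ hA a =>
    congrArg (Structure.funMap f) (funext fun i => h i A hA a)

/-- The `V`-free algebra over `X`: terms modulo the identities of `V`, generated by the classes
of the variables. -/
abbrev FreeAlgebra (V : Variety.{u, v, w} L) [L.IsAlgebraic] (X : Type*) : Type _ :=
  Quotient (V.identityCongruence X).toSetoid

end Variety

/-! ### Coloured ordered trees -/

/-- Finite rooted ordered trees: `node n sub` is the tree whose root has exactly `n` children, in
the order of `Fin n`, the `i`-th of which is the root of the subtree `sub i`. -/
inductive OrderedTree : Type
  | node (n : ℕ) (sub : Fin n → OrderedTree) : OrderedTree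

namespace OrderedTree

/-- The nodes of an ordered tree. -/
inductive Node : OrderedTree → Type
  | root (T : OrderedTree) : Node T
  | inSubtree {n : ℕ} {sub : Fin n → OrderedTree} (i : Fin n) (p : Node (sub i)) :
      Node (OrderedTree.node n sub)

/-- The number of children of a node. A leaf is a node without children. -/
def Node.numChildren : {T : OrderedTree} → Node T → ℕ
  | .node n _, .root _ => n
  | _, .inSubtree _ p => p.numChildren

/-- The children of a node, in increasing order. -/
def Node.child : {T : OrderedTree} → (p : Node T) → Fin p.numChildren → Node T
  | .node _ sub, .root _ => fun i => .inSubtree i (.root (sub i))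
  | _, .inSubtree j p => fun i => .inSubtree j (p.child i)

end OrderedTree

/-- The two colours. -/
inductive Colour : Type
  | blue
  | green

/-- The opposite colour. -/
def Colour.opposite : Colour → Colour
  | .blue => .green
  | .green => .blue

/-- A finite rooted ordered tree with a colouring of its nodes by blue and green such that
the colour of a child is always opposite to the colour of its parent. -/
structure ColouredTree where
  tree : OrderedTree
  colour : tree.Node → Colour
  colour_child : ∀ (p : tree.Node) (i : Fin p.numChildren),
    colour (p.child i) = (colour p).opposite

open Colour in
/-- The variety `V` satisfies the condition `C₂(T)`: there are ternary terms `s_p`, `t_p`, indexed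
by the nodes `p` of `T`, such that the listed equations are identities of `V`. The first child of
a node `p` is the one with index `0`, the last child is the one with index `i` such that
`i + 1 = p.numChildren`. -/
def Variety.SatisfiesC2Tree {L : FirstOrder.Language.{u, v}} (V : Variety.{u, v, w} L)
    (T : ColouredTree) : Prop :=
  ∃ s t : T.tree.Node → TernaryTerm L,
    ∀ (A : Type (max u w)) [L.Structure A], V.Mem A →
      (∀ x y z : A, (s (.root T.tree)).eval x y z = x ∧ (t (.root T.tree)).eval x y z = z) ∧
      (∀ p, ∀ x y : A, (s p).eval x y x = (t p).eval x y x) ∧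
      -- the first child of a node
      (∀ p, ∀ i : Fin p.numChildren, (i : ℕ) = 0 → T.colour p = blue →
        ∀ x y : A, (s p).eval x x y = (s (p.child i)).eval x x y) ∧
      (∀ p, ∀ i : Fin p.numChildren, (i : ℕ) = 0 → T.colour p = green →
        ∀ x y : A, (s p).eval x y y = (s (p.child i)).eval x y y) ∧
      -- the last child of a node
      (∀ p, ∀ i : Fin p.numChildren, (i : ℕ) + 1 = p.numChildren → T.colour p = blue →
        ∀ x y : A, (t p).eval x x y = (t (p.child i)).eval x x y) ∧
      (∀ p, ∀ i : Fin p.numChildren, (i : ℕ) + 1 = p.numChildren → T.colour p = green →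
        ∀ x y : A, (t p).eval x y y = (t (p.child i)).eval x y y) ∧
      -- consecutive children of a node
      (∀ p, ∀ i j : Fin p.numChildren, (i : ℕ) + 1 = j → T.colour p = blue →
        ∀ x y : A, (t (p.child i)).eval x x y = (s (p.child j)).eval x x y) ∧
      (∀ p, ∀ i j : Fin p.numChildren, (i : ℕ) + 1 = j → T.colour p = green →
        ∀ x y : A, (t (p.child i)).eval x y y = (s (p.child j)).eval x y y) ∧
      -- leaves
      (∀ p, p.numChildren = 0 → T.colour p = blue →
        ∀ x y : A, (s p).eval x x y = (t p).eval x x y) ∧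
      (∀ p, p.numChildren = 0 → T.colour p = green →
        ∀ x y : A, (s p).eval x y y = (t p).eval x y y)

end UnivAlg

namespace UnivAlg

open FirstOrder FirstOrder.Language

/-! ### Congruences: basic closure properties -/

namespace Congruence

variable {L : FirstOrder.Language.{u, v}} {A : Type w} [L.Structure A]

/-! Two circuits of implications meet in the trees of terms, condition 5.

From meet-semidistributivity to terms: the unions `β_ω` and `γ_ω` are congruences with `α ∩ β_ω = α
∩ γ_ω`, so semidistributivity puts `α ∩ (β ∘ γ)` inside `β_ω`, which is `C₂`. In the free algebra on
`x, y, z`, let `α`, `β`, `γ` be the kernels of the renamings that identify `x, z`, then `x, y`, then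
`y, z`. By `C₂` the pair `(x, z)` lies in some `β_n`. Unfolding this membership, with joins written
as chains, gives a finite tree of pairs of elements; representing terms satisfy `C₂(T)`
(`exists_satisfiesC2Tree`).

Back from terms: in any member of the variety, an induction from the leaves to the root gives `C₂`.
The same induction on equalities gives condition 6, whose biconditionals switch the middle argument
between the colours.

Condition 6 gives condition 7: if `Cg(a_0, a_n)` met every link trivially, then whether `s_p(a_0, b,
a_n) = t_p(a_0, b, a_n)` holds would not change as `b` runs through the `a_i`, forcing `a_0 = a_n`.
Applied in the quotient by `α ∩ β = α ∩ γ`, condition 7 shows that a chain from `β` and `γ` whose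
ends are `α`-related has its ends identified, which is meet-semidistributivity. -/

theorem Rel.refl (θ : Congruence L A) (a : A) : θ.Rel a a := θ.refl' a

theorem Rel.symm {θ : Congruence L A} {a b : A} (h : θ.Rel a b) : θ.Rel b a := θ.symm' h

theorem Rel.trans {θ : Congruence L A} {a b c : A} (h : θ.Rel a b) (k : θ.Rel b c) : θ.Rel a c :=
  θ.trans' h k

theorem Rel.mono {θ ψ : Congruence L A} (h : θ ≤ ψ) {a b : A} (k : θ.Rel a b) : ψ.Rel a b := h k

theorem le_of_rel {θ ψ : Congruence L A} (h : ∀ a b, θ.Rel a b → ψ.Rel a b) : θ ≤ ψ :=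
  fun a b k => h a b k

theorem rel_bot {a b : A} : (⊥ : Congruence L A).Rel a b ↔ a = b := Iff.rfl

theorem rel_Cg (a b : A) : (Cg L a b).Rel a b := fun _ h => h

theorem Cg_le {θ : Congruence L A} {a b : A} (h : θ.Rel a b) : Cg L a b ≤ θ := sInf_le h

theorem rel_realize (θ : Congruence L A) {X : Type*} (t : L.Term X) {x y : X → A}
    (h : ∀ i, θ.Rel (x i) (y i)) : θ.Rel (t.realize x) (t.realize y) := by
  induction t with
  | var i => exact h i
  | func f ts ih => exact θ.compat f _ _ ih

theorem rel_eval (θ : Congruence L A) (t : TernaryTerm L) {a a' b b' c c' : A}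
    (ha : θ.Rel a a') (hb : θ.Rel b b') (hc : θ.Rel c c') :
    θ.Rel (t.eval a b c) (t.eval a' b' c') :=
  θ.rel_realize t (by intro i; fin_cases i <;> assumption)

/-! ### Joins as chains -/

theorem rel_funMap_update {θ : Congruence L A} {n : ℕ} (f : L.Functions n) (z : Fin n → A)
    (i : Fin n) {a b : A} (h : θ.Rel a b) :
    θ.Rel (Structure.funMap f (Function.update z i a))
      (Structure.funMap f (Function.update z i b)) := by
  refine θ.compat f _ _ fun j => ?_
  by_cases hj : j = i
  · subst hj
    simp only [Function.update_self]
    exact h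
  · simpa only [Function.update_of_ne hj] using θ.refl' (z j)

/-- The congruence of all pairs that are joined by a chain of links from `θ` and `ψ`. -/
def chain (θ ψ : Congruence L A) : Congruence L A where
  r := Relation.ReflTransGen fun a b => θ.Rel a b ∨ ψ.Rel a b
  iseqv :=
    ⟨fun _ => .refl,
      fun h => by
        have : Std.Symm fun a b => θ.Rel a b ∨ ψ.Rel a b := ⟨fun _ _ k => k.imp Rel.symm Rel.symm⟩
        exact symm h,
      Relation.ReflTransGen.trans⟩
  compat := by
    intro n f x y h
    -- The arguments are changed one coordinate at a time: the chain in each coordinate is lifted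
    -- through `f` with the others held fixed.
    suffices H : ∀ S : Finset (Fin n),
        Relation.ReflTransGen (fun a b => θ.Rel a b ∨ ψ.Rel a b)
          (Structure.funMap f x) (Structure.funMap f (S.piecewise y x)) by
      simpa using H Finset.univ
    intro S
    induction S using Finset.induction_on with
    | empty => simpa using Relation.ReflTransGen.refl
    | insert i S hi ih =>
      refine ih.trans ?_
      rw [Finset.piecewise_insert]
      have step := Relation.ReflTransGen.lift
        (r := fun a b => θ.Rel a b ∨ ψ.Rel a b)
        (p := fun a b => θ.Rel a b ∨ ψ.Rel a b)
        (fun a => Structure.funMap f (Function.update (S.piecewise y x) i a))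
        (fun a b hab => hab.imp (rel_funMap_update f _ i) (rel_funMap_update f _ i)) _ _ (h i)
      have hx : Function.update (S.piecewise y x) i (x i) = S.piecewise y x := by
        rw [Function.update_eq_self_iff, Finset.piecewise_eq_of_notMem _ _ _ hi]
      simpa only [Function.onFun, hx] using step

theorem reflTransGen_of_rel_sup {θ ψ : Congruence L A} {a b : A} (h : (θ ⊔ ψ).Rel a b) :
    Relation.ReflTransGen (fun a b => θ.Rel a b ∨ ψ.Rel a b) a b :=
  (sup_le (le_of_rel fun _ _ h => Relation.ReflTransGen.single (.inl h))
      (le_of_rel fun _ _ h => Relation.ReflTransGen.single (.inr h)) :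
    θ ⊔ ψ ≤ chain θ ψ) h

/-! ### Directed unions and the relation `β_ω` -/

/-- The union of an ascending sequence of congruences. -/
def iUnion (θ : ℕ → Congruence L A) (hθ : Monotone θ) : Congruence L A where
  r a b := ∃ n, (θ n).Rel a b
  iseqv :=
    ⟨fun a => ⟨0, Rel.refl _ a⟩, fun ⟨n, h⟩ => ⟨n, h.symm⟩, fun ⟨m, h⟩ ⟨n, k⟩ =>
      ⟨max m n, (h.mono (hθ (le_max_left m n))).trans (k.mono (hθ (le_max_right m n)))⟩⟩
  compat := by
    intro k f x y h
    choose n hn using h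
    exact ⟨Finset.univ.sup n, (θ _).compat f x y fun i =>
      (hn i).mono (hθ (Finset.le_sup (Finset.mem_univ i)))⟩

/-- `β` for the colour blue, and `γ` for the colour green. -/
def ofColour (β γ : Congruence L A) : Colour → Congruence L A
  | .blue => β
  | .green => γ

/-- `β_n` for the colour blue, and `γ_n` for the colour green. -/
def level (α β γ : Congruence L A) (c : Colour) (n : ℕ) : Congruence L A :=
  ofColour (betaGamma α β γ n).1 (betaGamma α β γ n).2 c

variable (α β γ : Congruence L A)

theorem level_succ (c : Colour) (n : ℕ) :
    level α β γ c (n + 1) = ofColour β γ c ⊔ (α ⊓ level α β γ c.opposite n) := by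
  cases c <;> rfl

theorem level_le_succ (c : Colour) (n : ℕ) : level α β γ c n ≤ level α β γ c (n + 1) := by
  induction n generalizing c with
  | zero => rw [level_succ]; exact le_sup_left
  | succ n ih =>
    rw [level_succ, level_succ]
    exact sup_le_sup_left (inf_le_inf_left α (ih _)) _

theorem level_mono (c : Colour) : Monotone (level α β γ c) :=
  monotone_nat_of_le_succ (level_le_succ α β γ c)

/-- The union of the `β_n` for the colour blue, and of the `γ_n` for the colour green. -/
def limit (c : Colour) : Congruence L A := iUnion _ (level_mono α β γ c)

theorem ofColour_le_limit (c : Colour) : ofColour β γ c ≤ limit α β γ c :=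
  le_of_rel fun _ _ h => ⟨0, h⟩

/-- Each level absorbs the meet of `α` with the previous level of the other colour, so `α` cuts both
limits in the same congruence. -/
theorem inf_limit_le (c d : Colour) : α ⊓ limit α β γ c ≤ limit α β γ d := by
  refine le_of_rel fun a b ⟨h, n, k⟩ => ?_
  by_cases hcd : c = d
  · subst hcd
    exact ⟨n, k⟩
  · have hc : c = d.opposite := by cases c <;> cases d <;> first | rfl | exact absurd rfl hcd
    subst hc
    refine ⟨n + 1, ?_⟩
    rw [level_succ]
    exact Rel.mono le_sup_right ⟨h, k⟩

/-! ### Quotients -/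

/-- The congruence `θ / δ` of the quotient algebra `A / δ`, for `δ ≤ θ`. -/
def quotient [L.IsAlgebraic] (θ δ : Congruence L A) (h : δ ≤ θ) :
    Congruence L (Quotient δ.toSetoid) where
  r := Quotient.lift₂ (fun a b => θ.Rel a b) fun _ _ _ _ ha hb => propext
    ⟨fun k => ((Rel.mono h ha).symm.trans k).trans (Rel.mono h hb),
      fun k => ((Rel.mono h ha).trans k).trans (Rel.mono h hb).symm⟩
  iseqv :=
    ⟨fun p => Quotient.inductionOn p fun a => Rel.refl θ a,
      fun {p q} => Quotient.inductionOn₂ p q fun _ _ => Rel.symm,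
      fun {p q r} => Quotient.inductionOn₃ p q r fun _ _ _ => Rel.trans⟩
  compat := by
    intro n f x y hxy
    choose x' hx' using fun i => Quotient.exists_rep (x i)
    choose y' hy' using fun i => Quotient.exists_rep (y i)
    obtain rfl : (fun i => ⟦x' i⟧) = x := funext hx'
    obtain rfl : (fun i => ⟦y' i⟧) = y := funext hy'
    have e := fun z : Fin n → A => funMap_quotient_mk' (s := δ.toSetoid) f z
    change Quotient.lift₂ _ _ _ _
    rw [e, e]
    exact θ.compat f x' y' hxy

/-- The projection onto a quotient algebra. -/
def mkHom [L.IsAlgebraic] (δ : Congruence L A) : A →[L] Quotient δ.toSetoid where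
  toFun a := Quotient.mk _ a
  map_fun' f x := (funMap_quotient_mk' (s := δ.toSetoid) f x).symm
  map_rel' r := isEmptyElim r

/-! ### Transfer along isomorphisms -/

variable {B : Type*} [L.Structure B]

/-- The inverse image of a congruence under an isomorphism. -/
def comap (e : A ≃[L] B) (θ : Congruence L B) : Congruence L A where
  r a b := θ.Rel (e a) (e b)
  iseqv := ⟨fun _ => Rel.refl _ _, Rel.symm, Rel.trans⟩
  compat f x y h := by
    rw [e.map_fun, e.map_fun]
    exact θ.compat f _ _ h

theorem rel_comap (e : A ≃[L] B) (θ : Congruence L B) (a b : A) :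
    (θ.comap e).Rel a b ↔ θ.Rel (e a) (e b) := Iff.rfl

theorem ext_rel {θ ψ : Congruence L A} (h : ∀ a b, θ.Rel a b ↔ ψ.Rel a b) : θ = ψ :=
  le_antisymm (le_of_rel fun a b => (h a b).1) (le_of_rel fun a b => (h a b).2)

/-- Isomorphic algebras have isomorphic congruence lattices. -/
def comapIso (e : A ≃[L] B) : Congruence L B ≃o Congruence L A where
  toFun := comap e
  invFun := comap e.symm
  left_inv θ := ext_rel fun a b => by simp [rel_comap]
  right_inv θ := ext_rel fun a b => by simp [rel_comap]
  map_rel_iff' := by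
    intro θ ψ
    refine ⟨fun h => le_of_rel fun a b k => ?_, fun h => le_of_rel fun a b k => Rel.mono h k⟩
    have := Rel.mono h (a := e.symm a) (b := e.symm b) (by simpa [rel_comap] using k)
    simpa [rel_comap] using this

theorem betaGamma_comapIso (e : A ≃[L] B) (α β γ : Congruence L B) (n : ℕ) :
    betaGamma (comapIso e α) (comapIso e β) (comapIso e γ) n =
      (comapIso e (betaGamma α β γ n).1, comapIso e (betaGamma α β γ n).2) := by
  induction n with
  | zero => rfl
  | succ n ih => simp [betaGamma, ih, map_sup, map_inf]

end Congruence

open Congruence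

/-! ### Properties of a single algebra -/

section Algebra

variable {L : FirstOrder.Language.{u, v}} {A : Type w} [L.Structure A]

/-- The free algebra may live in a smaller universe than the members of the variety and is only
isomorphic to one of them, so properties must be transported. -/
theorem CongruenceMeetSD.of_equiv {B : Type*} [L.Structure B] (e : A ≃[L] B)
    (h : CongruenceMeetSD L A) : CongruenceMeetSD L B := by
  intro x y z hxy
  apply (comapIso e).injective
  simpa only [map_sup, map_inf] using
    h (comapIso e x) (comapIso e y) (comapIso e z) (by simp only [← map_inf, hxy])

theorem SatisfiesC2.of_equiv {B : Type*} [L.Structure B] (e : A ≃[L] B)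
    (h : SatisfiesC2 L A) : SatisfiesC2 L B := by
  rintro α β γ x z hα ⟨y, hβ, hγ⟩
  obtain ⟨n, hn⟩ := h (comapIso e α) (comapIso e β) (comapIso e γ) (e.symm x) (e.symm z)
    (by simpa [comapIso, rel_comap] using hα)
    ⟨e.symm y, by simpa [comapIso, rel_comap] using hβ, by simpa [comapIso, rel_comap] using hγ⟩
  rw [betaGamma_comapIso] at hn
  exact ⟨n, by simpa [comapIso, rel_comap] using hn⟩

theorem CongruenceMeetSD.satisfiesC2 (h : CongruenceMeetSD L A) : SatisfiesC2 L A := by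
  rintro α β γ x z hα ⟨y, hβ, hγ⟩
  have key := h α (limit α β γ .blue) (limit α β γ .green)
    (le_antisymm (le_inf inf_le_left (inf_limit_le α β γ _ _))
      (le_inf inf_le_left (inf_limit_le α β γ _ _)))
  have hxz : (α ⊓ (limit α β γ .blue ⊔ limit α β γ .green)).Rel x z :=
    ⟨hα, ((hβ.mono (ofColour_le_limit α β γ .blue)).mono le_sup_left).trans
      ((hγ.mono (ofColour_le_limit α β γ .green)).mono le_sup_right)⟩
  rw [← key] at hxz
  exact hxz.2

/-- A chain of links, each from one of two relations, as a finite sequence. -/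
theorem exists_sequence_of_reflTransGen {X : Type*} {R : X → X → Prop} {a b : X}
    (h : Relation.ReflTransGen R a b) :
    ∃ (n : ℕ) (x : Fin (n + 1) → X), x 0 = a ∧ x (Fin.last n) = b ∧
      ∀ i : Fin n, R (x i.castSucc) (x i.succ) := by
  induction h with
  | refl => exact ⟨0, fun _ => a, rfl, rfl, fun i => i.elim0⟩
  | @tail b c _ hbc ih =>
    obtain ⟨n, x, h0, hn, hx⟩ := ih
    refine ⟨n + 1, Fin.snoc (α := fun _ => X) x c, ?_, by simp, fun i => ?_⟩
    · rw [← h0, ← Fin.castSucc_zero, Fin.snoc_castSucc]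
    · refine Fin.lastCases ?_ (fun j => ?_) i
      · rw [Fin.succ_last, Fin.snoc_last, Fin.snoc_castSucc, hn]
        exact hbc
      · rw [Fin.succ_castSucc, Fin.snoc_castSucc, Fin.snoc_castSucc]
        exact hx j

/-- Every sequence with distinct ends has a link whose principal congruence meets the principal
congruence of the ends. -/
def HasMeetingLinks (L : FirstOrder.Language.{u, v}) (A : Type w) [L.Structure A] : Prop :=
  ∀ (n : ℕ) (a : Fin (n + 1) → A), a 0 ≠ a (Fin.last n) →
    ∃ i : Fin n, Cg L (a 0) (a (Fin.last n)) ⊓ Cg L (a i.castSucc) (a i.succ) ≠ ⊥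

/-- Modulo `δ = α ⊓ β = α ⊓ γ`, both `β` and `γ` meet `α` trivially, so no link of a chain from `β`
and `γ` can meet the principal congruence of its `α`-related ends. -/
theorem congruenceMeetSD_of_hasMeetingLinks [L.IsAlgebraic]
    (h : ∀ δ : Congruence L A, HasMeetingLinks L (Quotient δ.toSetoid)) :
    CongruenceMeetSD L A := by
  intro α β γ hβγ
  refine le_antisymm (inf_le_inf_left α le_sup_left) (le_of_rel fun a c ⟨hα, hac⟩ => ?_)
  obtain ⟨n, x, h0, hn, hx⟩ := exists_sequence_of_reflTransGen (reflTransGen_of_rel_sup hac)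
  set δ := α ⊓ β with hδ
  suffices hq : (Quotient.mk δ.toSetoid (x 0)) = Quotient.mk δ.toSetoid (x (Fin.last n)) by
    have := Quotient.exact hq
    rw [h0, hn] at this
    exact this
  by_contra hne
  obtain ⟨i, hi⟩ := h δ n (fun j => Quotient.mk δ.toSetoid (x j)) hne
  -- The two principal congruences of the quotient lie below `α / δ` and `ψ / δ`, which intersect in
  -- equality.
  have hmeet : ∀ ψ : Congruence L A, α ⊓ ψ = δ → ψ.Rel (x i.castSucc) (x i.succ) → False := by
    intro ψ hψ hrel
    have h₁ : δ ≤ α := inf_le_left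
    have h₂ : δ ≤ ψ := hψ ▸ inf_le_right
    refine hi (le_bot_iff.1 (le_of_rel ?_))
    intro p q
    refine Quotient.inductionOn₂ p q fun a b hab => ?_
    have k₁ : (quotient α δ h₁).Rel ⟦a⟧ ⟦b⟧ := Rel.mono (Cg_le (by
      change α.Rel (x 0) (x (Fin.last n))
      rw [h0, hn]
      exact hα)) hab.1
    have k₂ : (quotient ψ δ h₂).Rel ⟦a⟧ ⟦b⟧ := Rel.mono
      (Cg_le (show (quotient ψ δ h₂).Rel ⟦_⟧ ⟦_⟧ from hrel)) hab.2
    have k : (α ⊓ ψ).Rel a b := ⟨k₁, k₂⟩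
    rw [hψ] at k
    exact Quotient.sound k
  rcases hx i with hi' | hi'
  · exact hmeet β rfl hi'
  · exact hmeet γ hβγ.symm hi'

theorem hasMeetingLinks_of_ternaryTerms {ι : Type*} {s t : ι → TernaryTerm L}
    (hst : ∀ p, ∀ x y : A, (s p).eval x y x = (t p).eval x y x)
    (hsep : ∀ x y : A, (∀ p, ((s p).eval x x y = (t p).eval x x y ↔
      (s p).eval x y y = (t p).eval x y y)) → x = y) : HasMeetingLinks L A := by
  intro n a hne
  by_contra! hbot
  refine hne (hsep _ _ fun p => ?_)
  set x := a 0
  set y := a (Fin.last n)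
  -- Replacing the last argument `y` by `x` makes the two terms agree.
  have hα : ∀ b, (Cg L x y).Rel ((s p).eval x b y) ((t p).eval x b y) := fun b => by
    have hx := Rel.refl (Cg L x y) x
    have hb := Rel.refl (Cg L x y) b
    have hyx := (rel_Cg (L := L) x y).symm
    have h := rel_eval _ (s p) hx hb hyx
    rw [hst] at h
    exact h.trans (rel_eval _ (t p) hx hb hyx).symm
  -- The pair of values at `c` lies both in `Cg(x, y)` and in the congruence of the link, hence in
  -- `⊥`.
  have hstep : ∀ (i : Fin n) (b c : A), (Cg L (a i.castSucc) (a i.succ)).Rel b c →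
      (s p).eval x b y = (t p).eval x b y → (s p).eval x c y = (t p).eval x c y := by
    intro i b c hbc heq
    have hx := Rel.refl (Cg L (a i.castSucc) (a i.succ)) x
    have hy := Rel.refl (Cg L (a i.castSucc) (a i.succ)) y
    have h := (rel_eval _ (s p) hx hbc hy).symm
    rw [heq] at h
    rw [← rel_bot (L := L), ← hbot i]
    exact ⟨hα c, h.trans (rel_eval _ (t p) hx hbc hy)⟩
  have hall : ∀ i : Fin (n + 1), ((s p).eval x x y = (t p).eval x x y ↔
      (s p).eval x (a i) y = (t p).eval x (a i) y) := by
    intro i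
    induction i using Fin.induction with
    | zero => rfl
    | succ i ih =>
      exact ih.trans ⟨hstep i _ _ (rel_Cg _ _), hstep i _ _ (rel_Cg _ _).symm⟩
  exact hall (Fin.last n)

end Algebra

/-! ### Labelled trees -/

/-- The middle argument `x` for the colour blue, and `y` for the colour green. -/
def Colour.select {A : Type*} (x y : A) : Colour → A
  | .blue => x
  | .green => y

namespace OrderedTree

/-- Induction from the leaves up to the root; leaves are covered because their hypothesis is
vacuous. -/
theorem Node.induction_children {T : OrderedTree} {P : T.Node → Prop}
    (h : ∀ p : T.Node, (∀ i, P (p.child i)) → P p) (p : T.Node) : P p := by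
  induction T with
  | node n sub ih =>
    have hsub : ∀ i (q : (sub i).Node), P (.inSubtree i q) := fun i q =>
      ih i (P := fun q => P (.inSubtree i q)) (fun q hq => h (.inSubtree i q) hq) q
    cases p with
    | root => exact h _ fun i => hsub i _
    | inSubtree i q => exact hsub i q

instance Node.finite (T : OrderedTree) : Finite T.Node := by
  induction T with
  | node n sub ih =>
    let f : Option (Σ i, (sub i).Node) → (node n sub).Node
      | none => .root _
      | some ⟨i, q⟩ => .inSubtree i q
    refine Finite.of_surjective f fun p => ?_
    cases p with
    | root => exact ⟨none, rfl⟩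
    | inSubtree i q => exact ⟨some ⟨i, q⟩, rfl⟩

/-- The alternating colouring of the nodes that gives the root the colour `c`. -/
def Node.alternating : {T : OrderedTree} → Colour → T.Node → Colour
  | _, c, .root _ => c
  | _, c, .inSubtree _ p => p.alternating c.opposite

theorem Node.alternating_child {T : OrderedTree} (c : Colour) (p : T.Node)
    (i : Fin p.numChildren) : (p.child i).alternating c = (p.alternating c).opposite := by
  induction p generalizing c with
  | root T => cases T; rfl
  | inSubtree j p ih => exact ih c.opposite i

/-- Adjacent intervals `[u, a 0], [b 0, a 1], …, [b (k - 1), v]` have `R`-related ends. -/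
structure IsLinked {X : Type*} (R : X → X → Prop) (u v : X) (k : ℕ) (a b : Fin k → X) : Prop where
  first : ∀ i : Fin k, (i : ℕ) = 0 → R u (a i)
  last : ∀ i : Fin k, (i : ℕ) + 1 = k → R v (b i)
  next : ∀ i j : Fin k, (i : ℕ) + 1 = j → R (b i) (a j)
  empty : k = 0 → R u v

/-- The inductive step of every leaf-to-root argument: walk from `u` to `v`, alternating gaps and
intervals. -/
theorem IsLinked.rel {X : Type*} {R S : X → X → Prop} {u v : X} {k : ℕ} {a b : Fin k → X}
    (h : IsLinked R u v k a b) (hS : Equivalence S) (hRS : ∀ x y, R x y → S x y)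
    (hab : ∀ i, S (a i) (b i)) : S u v := by
  rcases k.eq_zero_or_pos with hk | hk
  · exact hRS _ _ (h.empty hk)
  have hprefix : ∀ (m : ℕ) (hm : m < k), S u (b ⟨m, hm⟩) := by
    intro m
    induction m with
    | zero => exact fun hm => hS.trans (hRS _ _ (h.first _ rfl)) (hab _)
    | succ m ih =>
      intro hm
      exact hS.trans (ih (by omega)) (hS.trans (hRS _ _ (h.next _ ⟨m + 1, hm⟩ rfl)) (hab _))
  exact hS.trans (hprefix (k - 1) (by omega))
    (hS.symm (hRS _ _ (h.last ⟨k - 1, by omega⟩ (by simp; omega))))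

/-- The nodes of a coloured tree carry pairs such that the interval of each node is filled by
the intervals of its children, up to the relation of its colour. -/
def IsLabelling {X : Type*} {T : OrderedTree} (colour : T.Node → Colour)
    (E : Colour → X → X → Prop) (s t : T.Node → X) : Prop :=
  ∀ p : T.Node, IsLinked (E (colour p)) (s p) (t p) p.numChildren
    (fun i => s (p.child i)) (fun i => t (p.child i))

/-- The tree `T` with root of colour `c` has a labelling by pairs in `D` whose root
carries `(u, v)`. -/
def HasLabelling {X : Type*} (D : X → X → Prop) (E : Colour → X → X → Prop) (T : OrderedTree)
    (c : Colour) (u v : X) : Prop :=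
  ∃ s t : T.Node → X, s (.root T) = u ∧ t (.root T) = v ∧ (∀ p, D (s p) (t p)) ∧
    IsLabelling (Node.alternating c) E s t

/-- Label the root of a tree by `u` and the subtrees by the given labellings. -/
def Node.graft {X : Type*} {n : ℕ} {sub : Fin n → OrderedTree} (u : X)
    (s : ∀ i, (sub i).Node → X) : (node n sub).Node → X
  | .root _ => u
  | .inSubtree i p => s i p

theorem HasLabelling.node {X : Type*} {D : X → X → Prop} {E : Colour → X → X → Prop} {c : Colour}
    {u v : X} (huv : D u v) {k : ℕ} {a b : Fin k → X} (hab : IsLinked (E c) u v k a b)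
    {sub : Fin k → OrderedTree} (hsub : ∀ i, HasLabelling D E (sub i) c.opposite (a i) (b i)) :
    HasLabelling D E (.node k sub) c u v := by
  choose s t hs ht hD hE using hsub
  obtain rfl : (fun i => s i (.root _)) = a := funext hs
  obtain rfl : (fun i => t i (.root _)) = b := funext ht
  refine ⟨Node.graft u s, Node.graft v t, rfl, rfl, fun p => ?_, fun p => ?_⟩
  · cases p with
    | root => exact huv
    | inSubtree i q => exact hD i q
  · cases p with
    | root => exact hab
    | inSubtree i q => exact hE i q

/-- The `S`-links become the intervals; runs of `R`-links merge into gaps by transitivity. -/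
theorem exists_isLinked_of_reflTransGen {X : Type*} {R S : X → X → Prop} (hR : Equivalence R)
    {u v : X} (h : Relation.ReflTransGen (fun x y => R x y ∨ S x y) u v) :
    ∃ (k : ℕ) (a b : Fin k → X), IsLinked R u v k a b ∧ ∀ i, S (a i) (b i) := by
  induction h using Relation.ReflTransGen.head_induction_on with
  | refl =>
    exact ⟨0, Fin.elim0, Fin.elim0,
      ⟨fun i => i.elim0, fun i => i.elim0, fun i => i.elim0, fun _ => hR.refl v⟩,
      fun i => i.elim0⟩
  | @head u w huw _ ih =>
    obtain ⟨k, a, b, hab, hS⟩ := ih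
    rcases huw with huw | huw
    · exact ⟨k, a, b, ⟨fun i hi => hR.trans huw (hab.first i hi), hab.last, hab.next,
        fun hk => hR.trans huw (hab.empty hk)⟩, hS⟩
    · refine ⟨k + 1, Fin.cons u a, Fin.cons w b, ⟨?_, ?_, ?_, by simp⟩, ?_⟩
      · intro i hi
        obtain rfl : i = 0 := Fin.ext hi
        exact hR.refl u
      · intro i
        cases i using Fin.cases with
        -- The new first interval is also the last one exactly when the remaining chain has none.
        | zero => exact fun hi => hR.symm (hab.empty (by simpa using hi.symm))
        | succ i => exact fun hi => hab.last i (by simpa using hi)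
      · intro i j hij
        cases j using Fin.cases with
        | zero => simp at hij
        | succ j =>
          cases i using Fin.cases with
          | zero => exact hab.first j (by simpa using hij.symm)
          | succ i => exact hab.next i j (by simpa using hij)
      · intro i
        cases i using Fin.cases with
        | zero => exact huw
        | succ i => exact hS i

end OrderedTree

open OrderedTree

/-- Each level is a join, hence a chain; its links in `α` and the previous level of the opposite
colour become the children and carry trees by induction. -/
theorem exists_hasLabelling_of_rel_level {L : FirstOrder.Language.{u, v}} {A : Type w}
    [L.Structure A] (α β γ : Congruence L A) (n : ℕ) (c : Colour) {x y : A} (hα : α.Rel x y)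
    (h : (level α β γ c n).Rel x y) :
    ∃ T : OrderedTree, HasLabelling α.Rel (fun c => (ofColour β γ c).Rel) T c x y := by
  induction n generalizing c x y with
  | zero =>
    exact ⟨.node 0 Fin.elim0, .node (a := Fin.elim0) (b := Fin.elim0) hα
      ⟨fun i => i.elim0, fun i => i.elim0, fun i => i.elim0, fun _ => h⟩ fun i => i.elim0⟩
  | succ n ih =>
    rw [level_succ] at h
    obtain ⟨k, a, b, hab, hS⟩ :=
      exists_isLinked_of_reflTransGen (ofColour β γ c).iseqv (reflTransGen_of_rel_sup h)
    choose sub hsub using fun i => ih c.opposite (hS i).1 (hS i).2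
    exact ⟨.node k sub, .node hα hab hsub⟩

/-! ### Free algebras -/

namespace Variety

variable {L : FirstOrder.Language.{u, v}}

section FreeAlgebra

variable [L.IsAlgebraic] (V : Variety.{u, v, w} L)

/-- The value of an element of the free algebra under an assignment of the generators. -/
def liftFree {X : Type*} {A : Type (max u w)} [L.Structure A] (hA : V.Mem A) (a : X → A) :
    V.FreeAlgebra X → A :=
  Quotient.lift (fun t : L.Term X => t.realize a) fun _ _ h => h A hA a

theorem liftFree_funMap {X : Type*} {A : Type (max u w)} [L.Structure A] (hA : V.Mem A)
    (a : X → A) {n : ℕ} (f : L.Functions n) (x : Fin n → V.FreeAlgebra X) :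
    V.liftFree hA a (Structure.funMap f x) =
      Structure.funMap f fun i => V.liftFree hA a (x i) := by
  choose y hy using fun i => Quotient.exists_rep (x i)
  obtain rfl : (fun i => ⟦y i⟧) = x := funext hy
  have e := funMap_quotient_mk' (s := (V.identityCongruence X).toSetoid) f y
  rw [e]
  rfl

/-- The free algebra is isomorphic to a member of the variety. -/
theorem exists_mem_equiv_freeAlgebra (X : Type) [Nonempty X] :
    ∃ (B : Type (max u w)) (_ : L.Structure B), V.Mem B ∧ Nonempty (B ≃[L] V.FreeAlgebra X) := by
  have hwit : ∀ p : {p : L.Term X × L.Term X // ¬ V.Identity p.1 p.2},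
      ∃ (A : Type (max u w)) (_ : L.Structure A), V.Mem A ∧
        ∃ a : X → A, p.1.1.realize a ≠ p.1.2.realize a := by
    rintro ⟨p, hp⟩
    simpa only [Identity, not_forall, exists_prop] using hp
  choose A inst hA a ha using hwit
  -- One witness for each failing identity makes the product separate the elements of the free
  -- algebra; `ULift` puts the index set in the universe of the variety.
  let P := ∀ p : ULift.{w} {p : L.Term X × L.Term X // ¬ V.Identity p.1 p.2}, A p.down
  have hP : V.Mem P := V.product _ _ fun p => hA p.down
  let φ : V.FreeAlgebra X ↪[L] P :=
    { toFun := fun x p => V.liftFree (hA p.down) (a p.down) x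
      inj' := by
        intro x y
        refine Quotient.inductionOn₂ x y fun s t hst => ?_
        by_contra hne
        have hp : ¬ V.Identity s t := fun h => hne (Quotient.sound h)
        exact ha ⟨(s, t), hp⟩ (congrFun hst ⟨⟨(s, t), hp⟩⟩)
      map_fun' := fun f x => funext fun p => V.liftFree_funMap (hA p.down) (a p.down) f x
      map_rel' := fun r => isEmptyElim r }
  have hne : (φ.toHom.range : Set P).Nonempty :=
    ⟨_, Set.mem_range_self (Quotient.mk _ (.var (Classical.arbitrary X)))⟩
  exact ⟨φ.toHom.range, inferInstance, V.subalgebra P _ hne hP, ⟨φ.equivRange.symm⟩⟩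

/-- The congruence of the free algebra of all pairs that become identities of `V` when the
generators are renamed by `π`. -/
def renamingKernel {X Y : Type*} (π : X → Y) : Congruence L (V.FreeAlgebra X) where
  r p q := ∀ (A : Type (max u w)) [L.Structure A] (hA : V.Mem A) (a : Y → A),
    V.liftFree hA (a ∘ π) p = V.liftFree hA (a ∘ π) q
  iseqv :=
    ⟨fun _ _ _ _ _ => rfl, fun h A _ hA a => (h A hA a).symm,
      fun h k A _ hA a => (h A hA a).trans (k A hA a)⟩
  compat := fun f x y h A _ hA a => by
    rw [liftFree_funMap, liftFree_funMap]
    exact congrArg _ (funext fun i => h i A hA a)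

theorem rel_renamingKernel_var {X Y : Type*} {π : X → Y} {i j : X} (h : π i = π j) :
    (V.renamingKernel π).Rel (Quotient.mk _ (.var i)) (Quotient.mk _ (.var j)) :=
  fun _ _ _ a => congrArg a h

theorem realize_out_of_rel_renamingKernel {X Y : Type*} {π : X → Y} {p q : V.FreeAlgebra X}
    (h : (V.renamingKernel π).Rel p q) {A : Type (max u w)} [L.Structure A] (hA : V.Mem A)
    (a : Y → A) : p.out.realize (a ∘ π) = q.out.realize (a ∘ π) := by
  have := h A hA a
  rwa [← Quotient.out_eq p, ← Quotient.out_eq q] at this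

end FreeAlgebra

/-! ### The condition `C₂(T)` -/

/-- Choosing the middle argument by colour merges the eight clauses on children and leaves into one
labelling condition. -/
theorem satisfiesC2Tree_iff (V : Variety.{u, v, w} L) (T : ColouredTree) :
    V.SatisfiesC2Tree T ↔ ∃ s t : T.tree.Node → TernaryTerm L,
      ∀ (A : Type (max u w)) [L.Structure A], V.Mem A →
        (∀ x y z : A, (s (.root T.tree)).eval x y z = x ∧ (t (.root T.tree)).eval x y z = z) ∧
        (∀ p, ∀ x y : A, (s p).eval x y x = (t p).eval x y x) ∧
        ∀ x y : A, IsLabelling T.colour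
          (fun c p q => p.eval x (c.select x y) y = q.eval x (c.select x y) y) s t := by
  refine exists₂_congr fun s t => forall₃_congr fun A _ _ => and_congr_right fun _ =>
    and_congr_right fun _ => ⟨?_, fun h => ?_⟩
  · rintro ⟨fb, fg, lb, lg, nb, ng, eb, eg⟩ x y p
    cases hc : T.colour p with
    | blue =>
      exact ⟨fun i hi => fb p i hi hc x y, fun i hi => lb p i hi hc x y,
        fun i j hij => nb p i j hij hc x y, fun h0 => eb p h0 hc x y⟩
    | green =>
      exact ⟨fun i hi => fg p i hi hc x y, fun i hi => lg p i hi hc x y,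
        fun i j hij => ng p i j hij hc x y, fun h0 => eg p h0 hc x y⟩
  · refine ⟨?_, ?_, ?_, ?_, ?_, ?_, ?_, ?_⟩
    · intro p i hi hc x y
      simpa only [hc, Colour.select] using (h x y p).first i hi
    · intro p i hi hc x y
      simpa only [hc, Colour.select] using (h x y p).first i hi
    · intro p i hi hc x y
      simpa only [hc, Colour.select] using (h x y p).last i hi
    · intro p i hi hc x y
      simpa only [hc, Colour.select] using (h x y p).last i hi
    · intro p i j hij hc x y
      simpa only [hc, Colour.select] using (h x y p).next i j hij
    · intro p i j hij hc x y
      simpa only [hc, Colour.select] using (h x y p).next i j hij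
    · intro p h0 hc x y
      simpa only [hc, Colour.select] using (h x y p).empty h0
    · intro p h0 hc x y
      simpa only [hc, Colour.select] using (h x y p).empty h0

variable (V : Variety.{u, v, w} L)

theorem exists_satisfiesC2Tree [L.IsAlgebraic] (h : SatisfiesC2 L (V.FreeAlgebra (Fin 3))) :
    ∃ T : ColouredTree, V.SatisfiesC2Tree T := by
  let g : Fin 3 → V.FreeAlgebra (Fin 3) := fun i => Quotient.mk _ (.var i)
  -- The three renamings produce the argument patterns `(x, y, x)`, `(x, x, y)` and `(x, y, y)` of
  -- the identities.
  let α := V.renamingKernel (![0, 1, 0] : Fin 3 → Fin 2)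
  let β := V.renamingKernel (![0, 0, 1] : Fin 3 → Fin 2)
  let γ := V.renamingKernel (![0, 1, 1] : Fin 3 → Fin 2)
  have hα : α.Rel (g 0) (g 2) := V.rel_renamingKernel_var rfl
  obtain ⟨n, hn⟩ := h α β γ (g 0) (g 2) hα
    ⟨g 1, V.rel_renamingKernel_var rfl, V.rel_renamingKernel_var rfl⟩
  obtain ⟨T, s, t, hs, ht, hD, hE⟩ := exists_hasLabelling_of_rel_level α β γ n .blue hα hn
  refine ⟨⟨T, Node.alternating .blue, Node.alternating_child .blue⟩,
    (satisfiesC2Tree_iff V _).2 ⟨fun p => (s p).out, fun p => (t p).out, fun A _ hA => ?_⟩⟩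
  have hout : ∀ (p : V.FreeAlgebra (Fin 3)) (i : Fin 3), p = g i → ∀ x y z : A,
      TernaryTerm.eval p.out x y z = ![x, y, z] i := by
    rintro p i hp x y z
    exact Quotient.exact ((Quotient.out_eq p).trans hp) A hA ![x, y, z]
  have hvec : ∀ (x y : A) (i j k : Fin 2),
      ![x, y] ∘ ![i, j, k] = ![![x, y] i, ![x, y] j, ![x, y] k] := by
    intro x y i j k
    funext l
    fin_cases l <;> rfl
  refine ⟨fun x y z => ⟨hout _ 0 hs x y z, hout _ 2 ht x y z⟩, fun p x y => ?_, fun x y p => ?_⟩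
  · have := V.realize_out_of_rel_renamingKernel (hD p) hA ![x, y]
    rwa [hvec] at this
  · have key : ∀ (c : Colour) (a b : V.FreeAlgebra (Fin 3)), (ofColour β γ c).Rel a b →
        TernaryTerm.eval a.out x (c.select x y) y = TernaryTerm.eval b.out x (c.select x y) y := by
      intro c a b hab
      cases c with
      | blue =>
        have := V.realize_out_of_rel_renamingKernel (π := ![0, 0, 1]) hab hA ![x, y]
        rwa [hvec] at this
      | green =>
        have := V.realize_out_of_rel_renamingKernel (π := ![0, 1, 1]) hab hA ![x, y]
        rwa [hvec] at this
    exact ⟨fun i hi => key _ _ _ ((hE p).first i hi), fun i hi => key _ _ _ ((hE p).last i hi),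
      fun i j hij => key _ _ _ ((hE p).next i j hij), fun h0 => key _ _ _ ((hE p).empty h0)⟩

variable {V}

theorem SatisfiesC2Tree.satisfiesC2 {T : ColouredTree} (h : V.SatisfiesC2Tree T)
    {A : Type (max u w)} [L.Structure A] (hA : V.Mem A) : SatisfiesC2 L A := by
  obtain ⟨s, t, hst⟩ := (satisfiesC2Tree_iff V T).1 h
  obtain ⟨hroot, hD, hE⟩ := hst A hA
  rintro α β γ x z hα ⟨y, hβ, hγ⟩
  have hmid : ∀ c : Colour, (ofColour β γ c).Rel (c.select x z) y := by
    rintro (_ | _)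
    exacts [hβ, hγ.symm]
  have hαp : ∀ p, α.Rel ((s p).eval x y z) ((t p).eval x y z) := fun p => by
    have h₁ := α.rel_eval (s p) (Rel.refl α x) (Rel.refl α y) hα.symm
    rw [hD] at h₁
    exact h₁.trans (α.rel_eval (t p) (Rel.refl α x) (Rel.refl α y) hα)
  -- All colours at once: the pair lies in `α`, so the limit of the node's own colour suffices, and
  -- the children are needed in that same colour.
  have hlim : ∀ p : T.tree.Node, ∀ c,
      (limit α β γ c).Rel ((s p).eval x y z) ((t p).eval x y z) := by
    refine Node.induction_children fun p ih c => ?_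
    refine Rel.mono (inf_limit_le α β γ (T.colour p) c) ⟨hαp p, ?_⟩
    refine (hE x z p).rel
      (S := fun a b => (limit α β γ (T.colour p)).Rel (a.eval x y z) (b.eval x y z))
      ⟨fun _ => Rel.refl _ _, Rel.symm, Rel.trans⟩ (fun a b hab => ?_) fun i => ih i _
    have hev : ∀ r : TernaryTerm L, (limit α β γ (T.colour p)).Rel
        (r.eval x ((T.colour p).select x z) z) (r.eval x y z) := fun r =>
      rel_eval _ r (Rel.refl _ x) ((hmid _).mono (ofColour_le_limit α β γ _)) (Rel.refl _ z)
    have hb := hev b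
    rw [← hab] at hb
    exact (hev a).symm.trans hb
  have hres := hlim (.root T.tree) .blue
  rw [(hroot x y z).1, (hroot x y z).2] at hres
  exact hres

theorem SatisfiesC2Tree.exists_ternaryTerms {T : ColouredTree} (h : V.SatisfiesC2Tree T) :
    ∃ (m : ℕ) (s t : Fin m → TernaryTerm L),
      (∀ p, ∀ (A : Type (max u w)) [L.Structure A], V.Mem A →
        ∀ x y : A, (s p).eval x y x = (t p).eval x y x) ∧
      (∀ (A : Type (max u w)) [L.Structure A], V.Mem A →
        ∀ x y : A, x = y ↔
          ∀ p, ((s p).eval x x y = (t p).eval x x y ↔ (s p).eval x y y = (t p).eval x y y)) := by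
  obtain ⟨s, t, hst⟩ := (satisfiesC2Tree_iff V T).1 h
  obtain ⟨m, ⟨e⟩⟩ := Finite.exists_equiv_fin T.tree.Node
  refine ⟨m, s ∘ e.symm, t ∘ e.symm, fun p A _ hA => (hst A hA).2.1 _, fun A _ hA x y => ?_⟩
  obtain ⟨hroot, hD, hE⟩ := hst A hA
  constructor
  · rintro rfl p
    exact iff_of_true (hD _ x x) (hD _ x x)
  · intro hiff
    -- The children give equality for the colour of `p`; the biconditional at `p` carries it over to
    -- the other colour.
    have hall : ∀ p : T.tree.Node, ∀ c : Colour,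
        (s p).eval x (c.select x y) y = (t p).eval x (c.select x y) y := by
      refine Node.induction_children fun p ih => ?_
      have hp := (hE x y p).rel
        (S := fun a b => a.eval x ((T.colour p).select x y) y =
          b.eval x ((T.colour p).select x y) y)
        ⟨fun _ => rfl, Eq.symm, Eq.trans⟩ (fun _ _ h => h) fun i => ih i _
      have hip := hiff (e p)
      simp only [Function.comp_apply, Equiv.symm_apply_apply] at hip
      intro c
      cases hc : T.colour p <;> rw [hc] at hp <;> cases c
      exacts [hp, hip.1 hp, hip.2 hp, hp]
    have hr := hall (.root T.tree) .blue
    rwa [(hroot _ _ _).1, (hroot _ _ _).2] at hr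

end Variety

end UnivAlg

/-! ### The equivalences -/

theorem theorem2p1 (L : FirstOrder.Language.{u, v}) [L.IsAlgebraic]
    (V : UnivAlg.Variety.{u, v, w} L) :
    List.TFAE [
      -- 1. `V` is congruence meet-semidistributive
      ∀ (A : Type (max u w)) [L.Structure A], V.Mem A → UnivAlg.CongruenceMeetSD L A,
      -- 2. `V` satisfies `C₂`
      ∀ (A : Type (max u w)) [L.Structure A], V.Mem A → UnivAlg.SatisfiesC2 L A,
      -- 3. the 3-generated free algebra is congruence meet-semidistributive
      UnivAlg.CongruenceMeetSD L (V.FreeAlgebra (Fin 3)),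
      -- 4. the 3-generated free algebra satisfies `C₂`
      UnivAlg.SatisfiesC2 L (V.FreeAlgebra (Fin 3)),
      -- 5. `V` satisfies `C₂(T)` for some finite coloured ordered tree `T`
      ∃ T : UnivAlg.ColouredTree, V.SatisfiesC2Tree T,
      -- 6. a finite family of pairs of ternary terms
      ∃ (m : ℕ) (s t : Fin m → UnivAlg.TernaryTerm L),
        (∀ p, ∀ (A : Type (max u w)) [L.Structure A], V.Mem A →
          ∀ x y : A, (s p).eval x y x = (t p).eval x y x) ∧
        (∀ (A : Type (max u w)) [L.Structure A], V.Mem A →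
          ∀ x y : A, x = y ↔
            ∀ p, ((s p).eval x x y = (t p).eval x x y ↔ (s p).eval x y y = (t p).eval x y y)),
      -- 7. the condition on links of sequences
      ∀ (A : Type (max u w)) [L.Structure A], V.Mem A →
        ∀ (n : ℕ) (a : Fin (n + 1) → A), a 0 ≠ a (Fin.last n) →
          ∃ i : Fin n, UnivAlg.Congruence.Cg L (a 0) (a (Fin.last n)) ⊓
            UnivAlg.Congruence.Cg L (a i.castSucc) (a i.succ) ≠ ⊥
    ] := by
  tfae_have 1 → 3 := fun h => by
    obtain ⟨B, _, hB, ⟨e⟩⟩ := V.exists_mem_equiv_freeAlgebra (Fin 3)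
    exact (h B hB).of_equiv e
  tfae_have 3 → 4 := UnivAlg.CongruenceMeetSD.satisfiesC2
  tfae_have 4 → 5 := V.exists_satisfiesC2Tree
  tfae_have 5 → 2 := fun ⟨_, hT⟩ _ _ hA => hT.satisfiesC2 hA
  tfae_have 2 → 4 := fun h => by
    obtain ⟨B, _, hB, ⟨e⟩⟩ := V.exists_mem_equiv_freeAlgebra (Fin 3)
    exact (h B hB).of_equiv e
  tfae_have 5 → 6 := fun ⟨_, hT⟩ => hT.exists_ternaryTerms
  tfae_have 6 → 7 := fun ⟨_, _, _, hst, hsep⟩ A _ hA =>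
    UnivAlg.hasMeetingLinks_of_ternaryTerms (fun p => hst p A hA)
      fun x y => (hsep A hA x y).2
  tfae_have 7 → 1 := fun h A _ hA => UnivAlg.congruenceMeetSD_of_hasMeetingLinks fun δ =>
    h _ (V.hom_image A _ δ.mkHom Quotient.mk_surjective hA)
  tfae_finish
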